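/- **Setting.** Let $\mathbb R^{n_1\times n_2\times n_3}$ carry the Frobenius inner product $\langle\cdot,\cdot\rangle$ and norm $\|\cdot\|_F$. The t-product of $\mathcal A\in\mathbb R^{a\times b\times n_3}$ and $\mathcal B\in\mathbb R^{b\times c\times n_3}$ is $(\mathcal A*\mathcal B)^{(k)}=\sum_{s} A^{(k-s)}B^{(s)}$, where the frontal slices $A^{(0)},\dots,A^{(n_3-1)}$ are indexed modulo $n_3$ (equivalently, $\mathcal A*\mathcal B=\mathrm{fold}(\mathrm{bcirc}(\mathcal A)\,\mathrm{unfold}(\mathcal B))$); $\mathcal A^{T}$ has frontal slices $(A^{(-k)})^T$; $\mathcal I$ has the identity matrix as slice $0$ and zero slices otherwise; $\mathcal Q$ is orthogonal if $\mathcal Q^T*\mathcal Q=\mathcal Q*\mathcal Q^T=\mathcal I$. A t-SVD of $\mathcal X$ is a factorization $\mathcal X=\mathcal U*\mathcal S*\mathcal V^T$ with $\mathcal U\in\mathbb R^{n_1\times n_1\times n_3}$, $\mathcal V\in\mathbb R^{n_2\times n_2\times n_3}$ orthogonal and $\mathcal S\in\mathbb R^{n_1\times n_2\times n_3}$ f-diagonal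 (all frontal slices diagonal). The tubal rank $\mathrm{rank}_t(\mathcal X)$ is the number of nonzero tubes $\mathcal S(i,i,:)$ in a t-SVD of $\mathcal X$ (the least such number over all t-SVDs). The TRIP constant $\delta_r$ of a linear map $\Phi:\mathbb R^{n_1\times n_2\times n_3}\to\mathbb R^m$ is the smallest $\delta_r\ge 0$ such that $$(1-\delta_r)\|\mathcal X\|_F^2\le\|\Phi(\mathcal X)\|_2^2\le(1+\delta_r)\|\mathcal X\|_F^2\quad\text{whenever } \mathrm{rank}_t(\mathcal X)\le r .$$ A random linear map $\Phi(\mathcal X)=\frac1{\sqrt m}\big(\langle\mathcal A_1,\mathcal X\rangle,\dots,\langle\mathcal A_m,\mathcal X\rangle\big)$ is an $L$-subgaussian measurement ensemble if the random tensors $\mathcal A_1,\dots,\mathcal A_m$ are independent, isotropic ($\mathbb E\langle\mathcal A_i,\mathcal X\rangle^2=\|\mathcal X\|_F^2$ for all $\mathcal X$), and satisfy $\mathbb E\exp(t\langle\mathcal A_i,\mathcal X\rangle)\le\exp(L^2\|\mathcal X\|_F^2t^2/2)$ for all $\mathcal X$ and $t\in\mathbb R$. (This includes the case in which all entries of all $\mathcal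 A_i$ are independent $L$-subgaussian variables with mean zero and variance one.) A number $\alpha>0$ is a $\psi_2$-parameter of $\Phi$ if $\|\langle\mathcal A_i,\mathcal X\rangle\|_{\psi_2}\le\alpha\|\mathcal X\|_F$ for all $i$ and $\mathcal X$, where $\|Y\|_{\psi_2}=\inf\{c>0:\mathbb E\exp(Y^2/c^2)\le 2\}$. **Theorem 2 (TRIP for subgaussian measurement maps).** For every $L>0$ there is a constant $C>0$, depending only on $L$, such that the following holds. Let $n_1,n_2,n_3\ge 1$, $m\ge 0$ and $1\le r\le\min(n_1,n_2)$ be integers, let $\delta,\varepsilon\in(0,1)$, and let $\Phi:\mathbb R^{n_1\times n_2\times n_3}\to\mathbb R^m$ be a random draw of an $L$-subgaussian measurement ensemble with $\psi_2$-parameter $\alpha>0$. If $$m\ \ge\ C\,\alpha^2\,\delta^{-2}\max\big\{(r^2n_3+n_1rn_3+n_2rn_3)\log 2,\ \log(\varepsilon^{-1})\big\},$$ then $\mathbb P(\delta_r\le\delta)\ge 1-\varepsilon$. -/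

import Mathlib

open MeasureTheory ProbabilityTheory
open scoped NNReal ENNReal

/-- Real third-order tensors of size `n₁ × n₂ × n₃`. The inner product and the norm of this space
are the Frobenius inner product and the Frobenius norm; the entry `(i, j, k)` of `X` is
`X (i, j, k)`, and indices start at `0`. -/
abbrev Tensor3 (n₁ n₂ n₃ : ℕ) : Type := EuclideanSpace ℝ (Fin n₁ × Fin n₂ × Fin n₃)

namespace Tensor3

variable {n₁ n₂ n₃ l : ℕ}

/-- The frontal slices of a tensor, stacked on top of each other. -/
def unfoldMatrix (B : Tensor3 n₁ n₂ n₃) : Matrix (Fin n₃ × Fin n₁) (Fin n₂) ℝ :=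
  Matrix.of fun p j => B (p.2, j, p.1)

/-- The inverse of `unfoldMatrix`. -/
def foldMatrix (M : Matrix (Fin n₃ × Fin n₁) (Fin n₂) ℝ) : Tensor3 n₁ n₂ n₃ :=
  WithLp.toLp 2 fun q => M (q.2.2, q.1) q.2.1

/-- The block circulant matrix of a tensor: the block in block row `k` and block column `s` is
the frontal slice with index `k - s` modulo `n₃`. -/
def bcirc (A : Tensor3 n₁ n₂ n₃) : Matrix (Fin n₃ × Fin n₁) (Fin n₃ × Fin n₂) ℝ :=
  Matrix.of fun p q => A (p.2, q.2, p.1 - q.1)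

/-- The t-product of two tensors. -/
def tProd (A : Tensor3 n₁ n₂ n₃) (B : Tensor3 n₂ l n₃) : Tensor3 n₁ l n₃ :=
  foldMatrix (bcirc A * unfoldMatrix B)

/-- The (conjugate) transpose of a real tensor: every frontal slice is transposed, and the order
of all slices but the first is reversed. -/
def tTranspose [NeZero n₃] (A : Tensor3 n₁ n₂ n₃) : Tensor3 n₂ n₁ n₃ :=
  WithLp.toLp 2 fun q => A (q.2.1, q.1, -q.2.2)

/-- The identity tensor: the first frontal slice is the identity matrix, the others are zero. -/
def tId (n n₃ : ℕ) [NeZero n₃] : Tensor3 n n n₃ :=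
  WithLp.toLp 2 fun q => if q.1 = q.2.1 ∧ q.2.2 = 0 then 1 else 0

/-- Orthogonal tensors. -/
def IsOrthogonal {n n₃ : ℕ} [NeZero n₃] (Q : Tensor3 n n n₃) : Prop :=
  tProd (tTranspose Q) Q = tId n n₃ ∧ tProd Q (tTranspose Q) = tId n n₃

/-- A tensor is f-diagonal if every frontal slice is a diagonal matrix. -/
def IsFDiagonal (S : Tensor3 n₁ n₂ n₃) : Prop :=
  ∀ (i : Fin n₁) (j : Fin n₂) (k : Fin n₃), (i : ℕ) ≠ (j : ℕ) → S (i, j, k) = 0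

/-- `A = U * S * Vᵀ` is a t-SVD of `A`. -/
structure IsTSVD [NeZero n₃] (A : Tensor3 n₁ n₂ n₃) (U : Tensor3 n₁ n₁ n₃)
    (S : Tensor3 n₁ n₂ n₃) (V : Tensor3 n₂ n₂ n₃) : Prop where
  orthogonal_left : IsOrthogonal U
  orthogonal_right : IsOrthogonal V
  fDiagonal : IsFDiagonal S
  eq : A = tProd (tProd U S) (tTranspose V)

/-- The number of nonzero diagonal tubes `S(i, i, :)` of a tensor. -/
noncomputable def numSingularTubes (S : Tensor3 n₁ n₂ n₃) : ℕ :=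
  Set.ncard {p : Fin n₁ × Fin n₂ | (p.1 : ℕ) = (p.2 : ℕ) ∧ ∃ k : Fin n₃, S (p.1, p.2, k) ≠ 0}

/-- The tubal rank: the number of nonzero singular tubes in a t-SVD. A t-SVD is not unique, and
if the singular tubes are not sorted consistently in the Fourier domain it may show superfluous
nonzero tubes; the number that is meant, that of a sorted t-SVD, is the least possible one. -/
noncomputable def tubalRank [NeZero n₃] (A : Tensor3 n₁ n₂ n₃) : ℕ∞ :=
  ⨅ (U : Tensor3 n₁ n₁ n₃) (S : Tensor3 n₁ n₂ n₃) (V : Tensor3 n₂ n₂ n₃)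
    (_ : IsTSVD A U S V), (numSingularTubes S : ℕ∞)

variable {m : ℕ}

/-- `d` is an admissible constant in the tensor restricted isometry property of order `r`. -/
def IsTRIPBound [NeZero n₃] (Φ : Tensor3 n₁ n₂ n₃ →ₗ[ℝ] EuclideanSpace ℝ (Fin m)) (r : ℕ)
    (d : ℝ) : Prop :=
  ∀ X : Tensor3 n₁ n₂ n₃, tubalRank X ≤ (r : ℕ∞) →
    (1 - d) * ‖X‖ ^ 2 ≤ ‖Φ X‖ ^ 2 ∧ ‖Φ X‖ ^ 2 ≤ (1 + d) * ‖X‖ ^ 2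

/-- The TRIP constant `δ_r` of a linear map: the smallest admissible constant. (An admissible
constant is automatically nonnegative if there is a nonzero tensor of tubal rank at most `r`.) -/
noncomputable def tripConst [NeZero n₃]
    (Φ : Tensor3 n₁ n₂ n₃ →ₗ[ℝ] EuclideanSpace ℝ (Fin m)) (r : ℕ) : ℝ :=
  sInf {d : ℝ | 0 ≤ d ∧ IsTRIPBound Φ r d}

/-- The infimum in the definition of the TRIP constant is a minimum. -/
theorem isLeast_tripConst [NeZero n₃]
    (Φ : Tensor3 n₁ n₂ n₃ →ₗ[ℝ] EuclideanSpace ℝ (Fin m)) (r : ℕ) :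
    IsLeast {d : ℝ | 0 ≤ d ∧ IsTRIPBound Φ r d} (tripConst Φ r) := by
  have hb : BddBelow {d : ℝ | 0 ≤ d ∧ IsTRIPBound Φ r d} := ⟨0, fun d hd => hd.1⟩
  refine IsClosed.isLeast_csInf ?_ ?_ hb
  · have h : {d : ℝ | 0 ≤ d ∧ IsTRIPBound Φ r d} = Set.Ici 0 ∩
        ⋂ (X : Tensor3 n₁ n₂ n₃) (_ : tubalRank X ≤ (r : ℕ∞)),
          ({d : ℝ | (1 - d) * ‖X‖ ^ 2 ≤ ‖Φ X‖ ^ 2} ∩ {d : ℝ | ‖Φ X‖ ^ 2 ≤ (1 + d) * ‖X‖ ^ 2}) := by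
      ext d
      simp [IsTRIPBound]
    rw [h]
    refine isClosed_Ici.inter (isClosed_iInter fun X => isClosed_iInter fun _ => ?_)
    exact (isClosed_le (by fun_prop) (by fun_prop)).inter
      (isClosed_le (by fun_prop) (by fun_prop))
  · have hle : ∀ X, ‖Φ X‖ ≤ ‖LinearMap.toContinuousLinearMap Φ‖ * ‖X‖ := fun X =>
      (LinearMap.toContinuousLinearMap Φ).le_opNorm X
    refine ⟨1 + ‖LinearMap.toContinuousLinearMap Φ‖ ^ 2, by positivity, fun X _ => ⟨?_, ?_⟩⟩
    · nlinarith [sq_nonneg (‖LinearMap.toContinuousLinearMap Φ‖ * ‖X‖), sq_nonneg ‖Φ X‖]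
    · have h2 := pow_le_pow_left₀ (norm_nonneg _) (hle X) 2
      rw [mul_pow] at h2
      nlinarith [sq_nonneg ‖X‖]

/-- The linear measurement map `Φ(X) = m^(-1/2) (⟨A₁, X⟩, …, ⟨A_m, X⟩)` given by `m` tensors. -/
noncomputable def measurementMap (A : Fin m → Tensor3 n₁ n₂ n₃) :
    Tensor3 n₁ n₂ n₃ →ₗ[ℝ] EuclideanSpace ℝ (Fin m) where
  toFun X := WithLp.toLp 2 fun i => (Real.sqrt m)⁻¹ * inner ℝ (A i) X
  map_add' X Y := by
    ext i
    simp [inner_add_right, mul_add]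
  map_smul' c X := by
    ext i
    simp [inner_smul_right, mul_left_comm]

end Tensor3

/-- The `ψ₂` (Orlicz) norm of a real random variable. -/
noncomputable def psi2Norm {Ω : Type*} [MeasurableSpace Ω] (P : Measure Ω) (Y : Ω → ℝ) : ℝ≥0∞ :=
  ⨅ (c : ℝ) (_ : 0 < c) (_ : ∫⁻ ω, ENNReal.ofReal (Real.exp (Y ω ^ 2 / c ^ 2)) ∂P ≤ 2),
    ENNReal.ofReal c

/-- `A₁, …, A_m` are the measurement tensors of an `L`-subgaussian measurement ensemble: they are
independent and isotropic, and `⟨Aᵢ, X⟩` is `L‖X‖`-subgaussian for every `X`, that is,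
`E exp (t ⟨Aᵢ, X⟩) ≤ exp (L² ‖X‖² t² / 2)` for all real `t`. In particular, this holds if all
entries of all the `Aᵢ` are independent `L`-subgaussian variables with mean zero and variance one
(such as standard Gaussian or Rademacher variables, with `L = 1`). -/
structure IsSubgaussianEnsemble {Ω : Type*} [MeasurableSpace Ω] (P : Measure Ω) {m n₁ n₂ n₃ : ℕ}
    (L : ℝ≥0) (A : Fin m → Ω → Tensor3 n₁ n₂ n₃) : Prop where
  measurable : ∀ i, Measurable (A i)
  indep : iIndepFun A P
  isotropic : ∀ (i : Fin m) (X : Tensor3 n₁ n₂ n₃), ∫ ω, (inner ℝ (A i ω) X : ℝ) ^ 2 ∂P = ‖X‖ ^ 2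
  subgaussian : ∀ (i : Fin m) (X : Tensor3 n₁ n₂ n₃),
    HasSubgaussianMGF (fun ω => (inner ℝ (A i ω) X : ℝ)) (L ^ 2 * ‖X‖₊ ^ 2) P

/-- `α` is a `ψ₂`-parameter of the ensemble: `‖⟨Aᵢ, X⟩‖_{ψ₂} ≤ α ‖X‖` for all `i` and `X`. -/
def HasPsi2Parameter {Ω : Type*} [MeasurableSpace Ω] (P : Measure Ω) {m n₁ n₂ n₃ : ℕ}
    (α : ℝ) (A : Fin m → Ω → Tensor3 n₁ n₂ n₃) : Prop :=
  ∀ (i : Fin m) (X : Tensor3 n₁ n₂ n₃),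
    psi2Norm P (fun ω => (inner ℝ (A i ω) X : ℝ)) ≤ ENNReal.ofReal (α * ‖X‖)

/-!
For a fixed tensor `Z` the quantity `‖Φ Z‖² / ‖Z‖²` is an average of `m` independent squares of
subgaussian variables of variance one, so it deviates from `1` by more than `t ≤ 1` with probability
at most `2 exp (-c m t²)`, where `c` depends on `L` only
(`Tensor3.measureReal_norm_sq_measurementMap_le`). By polarization the same holds for the form
`B(X, Y) = ⟨Φ X, Φ Y⟩ - ⟨X, Y⟩` at any fixed pair `X`, `Y` in the unit ball, without any condition on
tubal ranks.

A tensor of tubal rank at most `r` is a t-product `A * B`, where `A` has size `n₁ × r × n₃`, left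
multiplication by `A` is isometric, and `‖B‖ = ‖X‖`
(`Tensor3.exists_factorization_of_tubalRank_le`). It is therefore the image of a pair in the product
of two unit balls, of operators and of tensors, in spaces of dimension at most `n₁ r n₃` and
`r n₂ n₃`. By a volume count these balls have `1/8`-nets with at most `17 ^ dim` points
(`exists_net_unitBall`).

The passage from the nets to all products controls the bilinear form `B` on pairs of products and not
only its diagonal (`abs_bilin_le_of_net`). If `A'` and `B'` are net points next to `A` and `B`, then
`A * B - A' * B' = (A - A') * B + A' * (B - B')` is a sum of two products of norm at most `1/8`, hence
the supremum `N` of `|B|` over pairs satisfies `N ≤ θ + N / 2`, where `θ` is the maximum over net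
points. The mesh of the nets thus stays fixed while `δ` tends to `0`, and no factor `log (1/δ)`
appears in the bound on `m`.

The union bound over pairs of pairs of net points then gives the result. Isotropy forces `1 ≤ α`
(`one_le_of_psi2Norm_le`), so that the factor `α²` in the condition on `m` only makes it stronger.
-/

/-! ### Nets of unit balls and bilinear forms on products -/

section Nets

open Module Metric

/-- The balls of radius `1/16` around the points are disjoint and lie in the ball of radius `17/16`;
compare volumes. -/
theorem card_le_of_separated_unitBall {E : Type*} [NormedAddCommGroup E] [NormedSpace ℝ E]
    [FiniteDimensional ℝ E] (s : Finset E) (hs : ∀ c ∈ s, ‖c‖ ≤ 1)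
    (h : ∀ c ∈ s, ∀ d ∈ s, c ≠ d → 1 / 8 ≤ ‖c - d‖) : s.card ≤ 17 ^ finrank ℝ E := by
  borelize E
  let μ : Measure E := Measure.addHaar
  have hdisj : Set.Pairwise (s : Set E)
      (Function.onFun Disjoint fun c => ball (c : E) (1 / 16)) := by
    rintro c hc d hd hcd
    apply ball_disjoint_ball
    rw [dist_eq_norm]
    have := h c hc d hd hcd
    linarith
  have hsub : ⋃ c ∈ s, ball (c : E) (1 / 16) ⊆ ball (0 : E) (17 / 16) := by
    refine Set.iUnion₂_subset fun x hx => ball_subset_ball' ?_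
    rw [dist_zero_right]
    linarith [hs x hx]
  have hvol : (s.card : ℝ≥0∞) * ENNReal.ofReal ((1 / 16) ^ finrank ℝ E) * μ (ball 0 1) ≤
      ENNReal.ofReal ((17 / 16) ^ finrank ℝ E) * μ (ball 0 1) :=
    calc
      (s.card : ℝ≥0∞) * ENNReal.ofReal ((1 / 16) ^ finrank ℝ E) * μ (ball 0 1)
          = μ (⋃ c ∈ s, ball (c : E) (1 / 16)) := by
        rw [measure_biUnion_finset hdisj fun c _ => measurableSet_ball]
        simp only [μ.addHaar_ball_of_pos _ (by norm_num : (0 : ℝ) < 1 / 16)]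
        simp only [Finset.sum_const, nsmul_eq_mul, mul_assoc]
      _ ≤ μ (ball (0 : E) (17 / 16)) := measure_mono hsub
      _ = ENNReal.ofReal ((17 / 16) ^ finrank ℝ E) * μ (ball 0 1) :=
        μ.addHaar_ball_of_pos _ (by norm_num)
  have hcard : (s.card : ℝ≥0∞) * ENNReal.ofReal ((1 / 16) ^ finrank ℝ E) ≤
      ENNReal.ofReal ((17 / 16) ^ finrank ℝ E) :=
    (ENNReal.mul_le_mul_iff_left (measure_ball_pos _ _ zero_lt_one).ne' measure_ball_lt_top.ne).1
      hvol
  have hreal := ENNReal.toReal_le_of_le_ofReal (by positivity) hcard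
  rw [ENNReal.toReal_mul, ENNReal.toReal_natCast, ENNReal.toReal_ofReal (by positivity),
    div_pow, div_pow, one_pow, mul_one_div, div_le_div_iff_of_pos_right (by positivity)] at hreal
  exact_mod_cast hreal

/-- A `1/8`-separated subset of the unit ball with the largest possible number of points is a
`1/8`-net. -/
theorem exists_net_unitBall (E : Type*) [NormedAddCommGroup E] [NormedSpace ℝ E]
    [FiniteDimensional ℝ E] :
    ∃ s : Finset E, s.card ≤ 17 ^ finrank ℝ E ∧ (∀ c ∈ s, ‖c‖ ≤ 1) ∧
      ∀ x : E, ‖x‖ ≤ 1 → ∃ c ∈ s, ‖x - c‖ ≤ 1 / 8 := by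
  classical
  let N : Set ℕ := {k | ∃ s : Finset E, s.card = k ∧ (∀ c ∈ s, ‖c‖ ≤ 1) ∧
    ∀ c ∈ s, ∀ d ∈ s, c ≠ d → 1 / 8 ≤ ‖c - d‖}
  have hbdd : BddAbove N := by
    refine ⟨17 ^ finrank ℝ E, ?_⟩
    rintro _ ⟨s, rfl, h₁, h₂⟩
    exact card_le_of_separated_unitBall s h₁ h₂
  obtain ⟨s, hcard, h₁, h₂⟩ := Nat.sSup_mem (s := N) ⟨0, ∅, by simp⟩ hbdd
  refine ⟨s, card_le_of_separated_unitBall s h₁ h₂, h₁, fun x hx => ?_⟩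
  -- Otherwise `x` could be added to the separated set `s` of maximal size.
  by_contra! hfar
  have hxs : x ∉ s := fun hmem => by
    have := hfar x hmem
    norm_num at this
  have hmem : (insert x s).card ∈ N := by
    refine ⟨insert x s, rfl, ?_, ?_⟩
    · simpa [hx] using h₁
    · intro c hc d hd hcd
      rcases Finset.mem_insert.1 hc with rfl | hc' <;>
        rcases Finset.mem_insert.1 hd with rfl | hd'
      · exact absurd rfl hcd
      · exact (hfar d hd').le
      · rw [norm_sub_rev]
        exact (hfar c hc').le
      · exact h₂ c hc' d hd' hcd
  have := le_csSup hbdd hmem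
  rw [Finset.card_insert_of_notMem hxs, hcard] at this
  omega

/-- A bound on a bilinear form at the values `a b`, for `a` and `b` in `1/8`-nets of the unit balls of
a space of operators and of its domain, extends to the whole unit balls at the cost of a factor `2`. -/
theorem abs_bilin_le_of_net {K H : Type*} [NormedAddCommGroup K] [NormedSpace ℝ K]
    [NormedAddCommGroup H] [NormedSpace ℝ H] (E : Submodule ℝ (K →L[ℝ] H))
    (B : H →L[ℝ] H →L[ℝ] ℝ) (s : Finset E) (t : Finset K)
    (hs₁ : ∀ c ∈ s, ‖c‖ ≤ 1) (hs : ∀ x : E, ‖x‖ ≤ 1 → ∃ c ∈ s, ‖x - c‖ ≤ 1 / 8)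
    (ht₁ : ∀ c ∈ t, ‖c‖ ≤ 1) (ht : ∀ x : K, ‖x‖ ≤ 1 → ∃ c ∈ t, ‖x - c‖ ≤ 1 / 8)
    (θ : ℝ) (hB : ∀ a ∈ s, ∀ b ∈ t, ∀ a' ∈ s, ∀ b' ∈ t, |B (a.1 b) (a'.1 b')| ≤ θ)
    (a : E) (b : K) (a' : E) (b' : K) (ha : ‖a‖ ≤ 1) (hb : ‖b‖ ≤ 1) (ha' : ‖a'‖ ≤ 1)
    (hb' : ‖b'‖ ≤ 1) : |B (a.1 b) (a'.1 b')| ≤ 2 * θ := by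
  let D : Set H := {x | ∃ (a : E) (b : K), ‖a‖ ≤ 1 ∧ ‖b‖ ≤ 1 ∧ x = a.1 b}
  let V : Set ℝ := {v | ∃ x ∈ D, ∃ y ∈ D, v = |B x y|}
  have hD : ∀ x ∈ D, ‖x‖ ≤ 1 := by
    rintro _ ⟨a, b, ha, hb, rfl⟩
    exact (a.1.le_opNorm b).trans (mul_le_one₀ ha (norm_nonneg _) hb)
  have hbdd : BddAbove V := by
    refine ⟨‖B‖ * 1 * 1, ?_⟩
    rintro _ ⟨x, hx, y, hy, rfl⟩
    calc |B x y| ≤ ‖B‖ * ‖x‖ * ‖y‖ := B.le_opNorm₂ x y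
      _ ≤ ‖B‖ * 1 * 1 := by
        gcongr
        exacts [hD x hx, hD y hy]
  have hle : ∀ x ∈ D, ∀ y ∈ D, |B x y| ≤ sSup V := fun x hx y hy =>
    le_csSup hbdd ⟨x, hx, y, hy, rfl⟩
  have hne : V.Nonempty :=
    ⟨_, a.1 b, ⟨a, b, ha, hb, rfl⟩, a'.1 b', ⟨a', b', ha', hb', rfl⟩, rfl⟩
  -- A point of `D` differs from a net point by a sum of two points of `D / 8`.
  have happrox : ∀ x ∈ D, ∃ c ∈ s, ∃ d ∈ t, ∃ u ∈ D, ∃ v ∈ D,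
      x = c.1 d + (1 / 8 : ℝ) • u + (1 / 8 : ℝ) • v := by
    rintro _ ⟨a, b, ha, hb, rfl⟩
    obtain ⟨c, hc, hac⟩ := hs a ha
    obtain ⟨d, hd, hbd⟩ := ht b hb
    refine ⟨c, hc, d, hd, ((8 : ℝ) • (a - c)).1 b, ⟨_, _, ?_, hb, rfl⟩,
      c.1 ((8 : ℝ) • (b - d)), ⟨_, _, hs₁ c hc, ?_, rfl⟩, ?_⟩
    · rw [Submodule.coe_norm] at hac ⊢
      rw [Submodule.coe_smul, norm_smul, Real.norm_of_nonneg (by norm_num)]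
      rw [Submodule.coe_sub] at hac ⊢
      linarith
    · rw [norm_smul, Real.norm_of_nonneg (by norm_num)]
      linarith
    · simp only [Submodule.coe_smul, Submodule.coe_sub, map_smul, map_sub, smul_apply, sub_apply,
        smul_smul]
      norm_num
      abel
  have hnetD : ∀ c ∈ s, ∀ d ∈ t, c.1 d ∈ D := fun c hc d hd =>
    ⟨c, d, hs₁ c hc, ht₁ d hd, rfl⟩
  -- The four error terms contribute `sSup V / 8` each.
  have hself : sSup V ≤ θ + sSup V / 2 := by
    refine csSup_le hne ?_
    rintro _ ⟨x, hx, y, hy, rfl⟩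
    obtain ⟨c, hc, d, hd, u, hu, v, hv, hx'⟩ := happrox x hx
    obtain ⟨c', hc', d', hd', u', hu', v', hv', hy'⟩ := happrox y hy
    have hexp : B x y = B (c.1 d) (c'.1 d') + 1 / 8 * B u (c'.1 d') + 1 / 8 * B v (c'.1 d')
        + 1 / 8 * B x u' + 1 / 8 * B x v' := by
      conv_lhs => rw [hy']
      simp only [map_add, map_smul, smul_eq_mul]
      rw [show B x (c'.1 d') = B (c.1 d + (1 / 8 : ℝ) • u + (1 / 8 : ℝ) • v) (c'.1 d') by
        rw [← hx']]
      simp only [map_add, map_smul, add_apply,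
        smul_apply, smul_eq_mul]
    have h₀ := abs_le.1 (hB c hc d hd c' hc' d' hd')
    have h₁ := abs_le.1 (hle u hu _ (hnetD c' hc' d' hd'))
    have h₂ := abs_le.1 (hle v hv _ (hnetD c' hc' d' hd'))
    have h₃ := abs_le.1 (hle x hx u' hu')
    have h₄ := abs_le.1 (hle x hx v' hv')
    rw [hexp, abs_le]
    constructor <;> linarith
  have := hle _ ⟨a, b, ha, hb, rfl⟩ _ ⟨a', b', ha', hb', rfl⟩
  linarith

end Nets

namespace Tensor3

/-! ### The algebra of the t-product -/

section Algebra

variable {n₁ n₂ n₃ l p : ℕ}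

theorem tProd_apply (A : Tensor3 n₁ n₂ n₃) (B : Tensor3 n₂ l n₃) (i : Fin n₁) (j : Fin l)
    (k : Fin n₃) : tProd A B (i, j, k) = ∑ u, ∑ a, A (i, a, k - u) * B (a, j, u) := by
  simp [tProd, foldMatrix, Matrix.mul_apply, bcirc, unfoldMatrix, Fintype.sum_prod_type]

theorem unfoldMatrix_tProd (A : Tensor3 n₁ n₂ n₃) (B : Tensor3 n₂ l n₃) :
    unfoldMatrix (tProd A B) = bcirc A * unfoldMatrix B := rfl

theorem unfoldMatrix_injective :
    Function.Injective (unfoldMatrix : Tensor3 n₁ n₂ n₃ → Matrix (Fin n₃ × Fin n₁) (Fin n₂) ℝ) := by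
  intro A B h
  ext ⟨i, j, k⟩
  exact congrFun (congrFun h (k, i)) j

theorem norm_sq_eq_trace (A : Tensor3 n₁ n₂ n₃) :
    ‖A‖ ^ 2 = ((unfoldMatrix A).transpose * unfoldMatrix A).trace := by
  rw [EuclideanSpace.real_norm_sq_eq]
  simp only [Matrix.trace, Matrix.diag, Matrix.mul_apply, Matrix.transpose_apply, unfoldMatrix,
    Matrix.of_apply, Fintype.sum_prod_type, ← sq]
  rw [Finset.sum_comm]
  exact Finset.sum_congr rfl fun j _ => Finset.sum_comm

theorem tProd_add_left (A A' : Tensor3 n₁ n₂ n₃) (B : Tensor3 n₂ l n₃) :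
    tProd (A + A') B = tProd A B + tProd A' B := by
  ext ⟨i, j, k⟩
  simp [tProd_apply, add_mul, Finset.sum_add_distrib]

theorem tProd_add_right (A : Tensor3 n₁ n₂ n₃) (B B' : Tensor3 n₂ l n₃) :
    tProd A (B + B') = tProd A B + tProd A B' := by
  ext ⟨i, j, k⟩
  simp [tProd_apply, mul_add, Finset.sum_add_distrib]

theorem tProd_smul_left (c : ℝ) (A : Tensor3 n₁ n₂ n₃) (B : Tensor3 n₂ l n₃) :
    tProd (c • A) B = c • tProd A B := by
  ext ⟨i, j, k⟩
  simp [tProd_apply, Finset.mul_sum, mul_assoc]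

theorem tProd_smul_right (c : ℝ) (A : Tensor3 n₁ n₂ n₃) (B : Tensor3 n₂ l n₃) :
    tProd A (c • B) = c • tProd A B := by
  ext ⟨i, j, k⟩
  simp [tProd_apply, Finset.mul_sum, mul_left_comm]

/-- Left multiplication in the t-product, as a linear map into the continuous linear maps with
their operator norm. -/
noncomputable def leftMul (n₁ n₂ n₃ l : ℕ) :
    Tensor3 n₁ n₂ n₃ →ₗ[ℝ] Tensor3 n₂ l n₃ →L[ℝ] Tensor3 n₁ l n₃ :=
  (LinearMap.toContinuousLinearMap :
    (Tensor3 n₂ l n₃ →ₗ[ℝ] Tensor3 n₁ l n₃) ≃ₗ[ℝ] _).toLinearMap ∘ₗ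
    LinearMap.mk₂ ℝ tProd tProd_add_left tProd_smul_left tProd_add_right tProd_smul_right

@[simp]
theorem leftMul_apply (A : Tensor3 n₁ n₂ n₃) (B : Tensor3 n₂ l n₃) :
    leftMul n₁ n₂ n₃ l A B = tProd A B := rfl

/-- If `Y` is supported on the rows in the range of `g`, restricting `Y` to these rows and `U` to
the corresponding columns changes neither the t-product nor the norm of `Y`. -/
theorem tProd_restrict_rows {r : ℕ} (g : Fin r → Fin n₂) (hg : Function.Injective g)
    (U : Tensor3 n₁ n₂ n₃) (Y : Tensor3 n₂ l n₃)
    (hY : ∀ i ∉ Set.range g, ∀ j k, Y (i, j, k) = 0) (A : Tensor3 n₁ r n₃) (B : Tensor3 r l n₃)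
    (hA : ∀ i a k, A (i, a, k) = U (i, g a, k)) (hB : ∀ a j k, B (a, j, k) = Y (g a, j, k)) :
    tProd A B = tProd U Y ∧ ‖B‖ = ‖Y‖ := by
  constructor
  · ext ⟨i, j, k⟩
    rw [tProd_apply, tProd_apply]
    refine Finset.sum_congr rfl fun u _ => Fintype.sum_of_injective g hg _ _ ?_ ?_
    · intro i' hi'
      rw [hY i' hi', mul_zero]
    · intro a
      rw [hA, hB]
  · rw [EuclideanSpace.norm_eq, EuclideanSpace.norm_eq]
    congr 1
    rw [Fintype.sum_prod_type, Fintype.sum_prod_type]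
    refine Fintype.sum_of_injective g hg _ _ ?_ ?_
    · intro i' hi'
      simp [hY i' hi']
    · intro a
      simp [hB]

variable [NeZero n₃]

theorem bcirc_injective :
    Function.Injective
      (bcirc : Tensor3 n₁ n₂ n₃ → Matrix (Fin n₃ × Fin n₁) (Fin n₃ × Fin n₂) ℝ) := by
  intro A B h
  ext ⟨i, j, k⟩
  simpa [bcirc] using congrFun (congrFun h (k, i)) (0, j)

theorem bcirc_tProd (A : Tensor3 n₁ n₂ n₃) (B : Tensor3 n₂ l n₃) :
    bcirc (tProd A B) = bcirc A * bcirc B := by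
  ext ⟨k, i⟩ ⟨s, j⟩
  simp only [Matrix.mul_apply, bcirc, Matrix.of_apply, tProd_apply, Fintype.sum_prod_type]
  refine Fintype.sum_equiv (Equiv.addRight s) _ _ fun u => ?_
  simp [sub_sub, add_comm]

theorem bcirc_tTranspose (A : Tensor3 n₁ n₂ n₃) : bcirc (tTranspose A) = (bcirc A).transpose := by
  ext ⟨k, i⟩ ⟨s, j⟩
  simp [bcirc, tTranspose]

theorem bcirc_tId (n : ℕ) : bcirc (tId n n₃) = 1 := by
  ext ⟨k, i⟩ ⟨s, j⟩
  simp [bcirc, tId, Matrix.one_apply, sub_eq_zero, and_comm]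

theorem tProd_assoc (A : Tensor3 n₁ n₂ n₃) (B : Tensor3 n₂ l n₃) (D : Tensor3 l p n₃) :
    tProd (tProd A B) D = tProd A (tProd B D) := by
  apply unfoldMatrix_injective
  simp only [unfoldMatrix_tProd, bcirc_tProd, Matrix.mul_assoc]

theorem tTranspose_tProd (A : Tensor3 n₁ n₂ n₃) (B : Tensor3 n₂ l n₃) :
    tTranspose (tProd A B) = tProd (tTranspose B) (tTranspose A) := by
  apply bcirc_injective
  simp only [bcirc_tTranspose, bcirc_tProd, Matrix.transpose_mul]

theorem tTranspose_tTranspose (A : Tensor3 n₁ n₂ n₃) : tTranspose (tTranspose A) = A := by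
  ext ⟨i, j, k⟩
  simp [tTranspose]

theorem norm_tTranspose (A : Tensor3 n₁ n₂ n₃) : ‖tTranspose A‖ = ‖A‖ := by
  rw [EuclideanSpace.norm_eq, EuclideanSpace.norm_eq]
  congr 1
  simp only [Fintype.sum_prod_type, tTranspose]
  rw [Finset.sum_comm]
  exact Finset.sum_congr rfl fun i _ => Finset.sum_congr rfl fun j _ =>
    Fintype.sum_equiv (Equiv.neg _) _ _ fun k => rfl

theorem norm_tProd_of_isOrthogonal {U : Tensor3 n₁ n₁ n₃} (hU : IsOrthogonal U)
    (Y : Tensor3 n₁ n₂ n₃) : ‖tProd U Y‖ = ‖Y‖ := by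
  have h : (bcirc U).transpose * bcirc U = 1 := by
    rw [← bcirc_tTranspose, ← bcirc_tProd, hU.1, bcirc_tId]
  rw [← sq_eq_sq₀ (norm_nonneg _) (norm_nonneg _), norm_sq_eq_trace, norm_sq_eq_trace,
    unfoldMatrix_tProd, Matrix.transpose_mul, Matrix.mul_assoc, ← Matrix.mul_assoc _ (bcirc U), h,
    Matrix.one_mul]

theorem norm_tProd_tTranspose_of_isOrthogonal {V : Tensor3 n₂ n₂ n₃} (hV : IsOrthogonal V)
    (Y : Tensor3 n₁ n₂ n₃) : ‖tProd Y (tTranspose V)‖ = ‖Y‖ := by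
  rw [← norm_tTranspose, tTranspose_tProd, tTranspose_tTranspose, norm_tProd_of_isOrthogonal hV,
    norm_tTranspose]

end Algebra

/-! ### Tensors of small tubal rank as products -/

section Factorization

variable {n₁ n₂ n₃ r : ℕ} [NeZero n₃]

theorem exists_isTSVD_of_tubalRank_le {X : Tensor3 n₁ n₂ n₃} (hX : tubalRank X ≤ (r : ℕ∞)) :
    ∃ U S V, IsTSVD X U S V ∧ numSingularTubes S ≤ r := by
  by_contra! h
  have hlt : ((r + 1 : ℕ) : ℕ∞) ≤ tubalRank X := by
    refine le_iInf fun U => le_iInf fun S => le_iInf fun V => le_iInf fun hSVD => ?_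
    exact_mod_cast h U S V hSVD
  have := hlt.trans hX
  norm_cast at this
  omega

/-- A tensor `U * S * Vᵀ` of tubal rank at most `r` is the product of `r` columns of `U` that contain
those belonging to the nonzero tubes of `S`, and of the corresponding rows of `S * Vᵀ`. -/
theorem exists_factorization_of_tubalRank_le (hr : r ≤ n₁) {X : Tensor3 n₁ n₂ n₃}
    (hX : tubalRank X ≤ (r : ℕ∞)) :
    ∃ (A : Tensor3 n₁ r n₃) (B : Tensor3 r n₂ n₃), X = tProd A B ∧ ‖B‖ = ‖X‖ ∧
      ∀ Z : Tensor3 r n₂ n₃, ‖tProd A Z‖ = ‖Z‖ := by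
  classical
  obtain ⟨U, S, V, hSVD, hcard⟩ := exists_isTSVD_of_tubalRank_le hX
  -- The at most `r` nonzero rows of `S`, filled up to exactly `r` rows.
  obtain ⟨g, hg, hS⟩ : ∃ g : Fin r → Fin n₁, Function.Injective g ∧
      ∀ i ∉ Set.range g, ∀ j k, S (i, j, k) = 0 := by
    let T : Set (Fin n₁ × Fin n₂) :=
      {p | (p.1 : ℕ) = (p.2 : ℕ) ∧ ∃ k : Fin n₃, S (p.1, p.2, k) ≠ 0}
    have hT : (Prod.fst '' T).toFinset.card ≤ r := by
      rw [← Set.ncard_eq_toFinset_card']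
      exact (Set.ncard_image_le (Set.toFinite T)).trans hcard
    obtain ⟨I, hTI, hI⟩ := Finset.exists_superset_card_eq hT (by simpa using hr)
    refine ⟨I.orderEmbOfFin hI, (I.orderEmbOfFin hI).injective, fun i hi j k => ?_⟩
    rw [Finset.range_orderEmbOfFin, Finset.mem_coe] at hi
    by_contra hne
    refine hi (hTI (Set.mem_toFinset.2 ⟨(i, j), ⟨?_, k, hne⟩, rfl⟩))
    by_contra hij
    exact hne (hSVD.fDiagonal i j k hij)
  let A : Tensor3 n₁ r n₃ := WithLp.toLp 2 fun q => U (q.1, g q.2.1, q.2.2)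
  let S' : Tensor3 r n₂ n₃ := WithLp.toLp 2 fun q => S (g q.1, q.2.1, q.2.2)
  obtain ⟨hAS, hnorm⟩ := tProd_restrict_rows g hg U S hS A S' (fun _ _ _ => rfl) fun _ _ _ => rfl
  refine ⟨A, tProd S' (tTranspose V), ?_, ?_, fun Z => ?_⟩
  · rw [← tProd_assoc, hAS, ← hSVD.eq]
  · rw [norm_tProd_tTranspose_of_isOrthogonal hSVD.orthogonal_right, hnorm, hSVD.eq,
      norm_tProd_tTranspose_of_isOrthogonal hSVD.orthogonal_right,
      norm_tProd_of_isOrthogonal hSVD.orthogonal_left]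
  · -- `A * Z` is `U * Z'` for the extension `Z'` of `Z` by zero rows.
    let Z' : Tensor3 n₁ n₂ n₃ := WithLp.toLp 2 fun q =>
      Function.extend g (fun a => Z (a, q.2.1, q.2.2)) 0 q.1
    obtain ⟨hAZ, hnormZ⟩ := tProd_restrict_rows g hg U Z'
      (fun i hi j k => Function.extend_apply' (fun a => Z (a, j, k)) (0 : Fin n₁ → ℝ) i hi) A Z
      (fun _ _ _ => rfl)
      fun a j k => (hg.extend_apply (fun a => Z (a, j, k)) 0 a).symm
    rw [hAZ, norm_tProd_of_isOrthogonal hSVD.orthogonal_left, hnormZ]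

end Factorization

end Tensor3

/-! ### Concentration of sums of squares of subgaussian variables -/

section Concentration

variable {Ω : Type*} [MeasurableSpace Ω] {P : Measure Ω}

/-- Up to the factor `√2`, the standard Gaussian density times `exp (g² / 4)` is the Gaussian density
of variance `2`. -/
theorem lintegral_exp_sq_div_four_gaussianReal_le :
    ∫⁻ g, ENNReal.ofReal (Real.exp (g ^ 2 / 4)) ∂(gaussianReal 0 1) ≤ 2 := by
  rw [gaussianReal_of_var_ne_zero 0 one_ne_zero,
    lintegral_withDensity_eq_lintegral_mul _ (measurable_gaussianPDF 0 1) (by fun_prop)]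
  calc ∫⁻ g, (gaussianPDF 0 1 * fun g => ENNReal.ofReal (Real.exp (g ^ 2 / 4))) g
      ≤ ∫⁻ g, 2 * ENNReal.ofReal (gaussianPDFReal 0 2 g) := by
        refine lintegral_mono fun g => ?_
        simp only [Pi.mul_apply, gaussianPDF]
        rw [← ENNReal.ofReal_mul (gaussianPDFReal_nonneg _ _ _),
          show (2 : ℝ≥0∞) = ENNReal.ofReal 2 by simp, ← ENNReal.ofReal_mul (by norm_num)]
        refine ENNReal.ofReal_le_ofReal ?_
        have hsqrt : √(2 * Real.pi * 2) ≤ 2 * √(2 * Real.pi) := by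
          rw [Real.sqrt_mul (by positivity), mul_comm]
          gcongr
          exact Real.sqrt_le_iff.2 (by norm_num)
        have hinv : (√(2 * Real.pi))⁻¹ ≤ 2 * (√(2 * Real.pi * 2))⁻¹ := by
          rw [← div_eq_mul_inv, inv_eq_one_div, div_le_div_iff₀ (by positivity) (by positivity)]
          linarith
        simp only [gaussianPDFReal, NNReal.coe_one, NNReal.coe_ofNat, sub_zero, mul_one]
        rw [mul_assoc, ← Real.exp_add, ← mul_assoc,
          show -g ^ 2 / 2 + g ^ 2 / 4 = -g ^ 2 / (2 * 2) by ring]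
        gcongr
    _ = 2 := by
        rw [lintegral_const_mul _ (by fun_prop), lintegral_gaussianPDFReal_eq_one 0 two_ne_zero,
          mul_one]

/-- The square of a subgaussian variable has an exponential moment. The reason is that
`exp (t² / 2)` is the Gaussian average of `exp (t * g)`, so that the moment generating function of
the variable controls the exponential of its square. -/
theorem lintegral_exp_sq_le_of_hasSubgaussianMGF [SFinite P] {Y : Ω → ℝ} {c : ℝ≥0} (hc : 0 < c)
    (hm : Measurable Y) (hY : HasSubgaussianMGF Y c P) :
    ∫⁻ ω, ENNReal.ofReal (Real.exp (Y ω ^ 2 / (4 * c))) ∂P ≤ 2 := by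
  have hc' : (0 : ℝ) < c := hc
  set τ : ℝ := √(1 / (2 * c)) with hτ
  have hτ2 : τ ^ 2 = 1 / (2 * c) := Real.sq_sqrt (by positivity)
  calc ∫⁻ ω, ENNReal.ofReal (Real.exp (Y ω ^ 2 / (4 * c))) ∂P
      = ∫⁻ ω, ∫⁻ g, ENNReal.ofReal (Real.exp (τ * Y ω * g)) ∂(gaussianReal 0 1) ∂P := by
        refine lintegral_congr fun ω => ?_
        rw [← ofReal_integral_eq_lintegral_ofReal (integrable_exp_mul_gaussianReal _)
          (ae_of_all _ fun _ => (Real.exp_pos _).le)]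
        have h := congrFun (mgf_fun_id_gaussianReal (μ := 0) (v := 1)) (τ * Y ω)
        rw [mgf] at h
        rw [h]
        congr 2
        rw [mul_pow, hτ2]
        push_cast
        field_simp
        ring
    _ = ∫⁻ g, ∫⁻ ω, ENNReal.ofReal (Real.exp (τ * Y ω * g)) ∂P ∂(gaussianReal 0 1) :=
        lintegral_lintegral_swap (by fun_prop)
    _ ≤ ∫⁻ g, ENNReal.ofReal (Real.exp (g ^ 2 / 4)) ∂(gaussianReal 0 1) := by
        refine lintegral_mono fun g => ?_
        have hre : ∀ ω, τ * Y ω * g = τ * g * Y ω := fun ω => by ring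
        simp only [hre]
        rw [← ofReal_integral_eq_lintegral_ofReal (hY.integrable_exp_mul _)
          (ae_of_all _ fun _ => (Real.exp_pos _).le)]
        refine ENNReal.ofReal_le_ofReal ((hY.mgf_le (τ * g)).trans (Real.exp_le_exp.2 ?_))
        rw [mul_pow, hτ2]
        field_simp
        linarith
    _ ≤ 2 := lintegral_exp_sq_div_four_gaussianReal_le

theorem exp_le_one_add_add_sq_mul_exp_abs (x : ℝ) :
    Real.exp x ≤ 1 + x + x ^ 2 * Real.exp |x| := by
  have h1 : 1 ≤ Real.exp |x| := Real.one_le_exp (abs_nonneg x)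
  rcases le_or_gt |x| 1 with hx | hx
  · have := (abs_le.1 (Real.abs_exp_sub_one_sub_id_le hx)).2
    nlinarith [sq_nonneg x]
  · rcases lt_abs.1 hx with hx | hx
    · rw [abs_of_pos (by linarith)]
      have : 0 ≤ (x ^ 2 - 1) * Real.exp x :=
        mul_nonneg (by nlinarith) (Real.exp_pos x).le
      linarith
    · have : Real.exp x ≤ 1 := Real.exp_le_one_iff.2 (by linarith)
      nlinarith [mul_le_mul_of_nonneg_left h1 (sq_nonneg x)]

/-- Bernstein's bound for the moment generating function near `0` of a nonnegative variable of mean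
one with an exponential moment. -/
theorem mgf_sub_one_le_of_lintegral_exp_le [IsProbabilityMeasure P] {W : Ω → ℝ} {κ : ℝ}
    (hκ : 0 < κ) (hm : Measurable W) (hW : ∀ ω, 0 ≤ W ω) (hmean : ∫ ω, W ω ∂P = 1)
    (hexp : ∫⁻ ω, ENNReal.ofReal (Real.exp (κ * W ω)) ∂P ≤ 2) {s : ℝ} (hs : |s| ≤ κ / 2) :
    Integrable (fun ω => Real.exp (s * (W ω - 1))) P ∧
      mgf (fun ω => W ω - 1) P s ≤ Real.exp (16 / κ ^ 2 * s ^ 2) := by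
  have hint : Integrable (fun ω => Real.exp (κ * W ω)) P := by
    refine ⟨by fun_prop, ?_⟩
    rw [hasFiniteIntegral_iff_ofReal (ae_of_all _ fun _ => (Real.exp_pos _).le)]
    exact hexp.trans_lt (by simp)
  have hint2 : ∫ ω, Real.exp (κ * W ω) ∂P ≤ 2 := by
    rw [integral_eq_lintegral_of_nonneg_ae (ae_of_all _ fun _ => (Real.exp_pos _).le) (by fun_prop)]
    exact ENNReal.toReal_le_of_le_ofReal (by norm_num) (by simpa using hexp)
  have hWint : Integrable W P := by
    by_contra h
    rw [integral_undef h] at hmean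
    norm_num at hmean
  have hsint : Integrable (fun ω => Real.exp (s * W ω)) P := by
    refine hint.mono' (by fun_prop) (ae_of_all _ fun ω => ?_)
    rw [Real.norm_of_nonneg (Real.exp_pos _).le, Real.exp_le_exp]
    exact mul_le_mul_of_nonneg_right (by linarith [le_abs_self s]) (hW ω)
  have hsplit : ∀ ω, Real.exp (s * (W ω - 1)) = Real.exp (-s) * Real.exp (s * W ω) := fun ω => by
    rw [← Real.exp_add]
    ring_nf
  refine ⟨by simpa only [hsplit] using hsint.const_mul _, ?_⟩
  have hpt : ∀ ω, Real.exp (s * W ω) ≤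
      1 + s * W ω + 8 / κ ^ 2 * s ^ 2 * Real.exp (κ * W ω) := by
    intro ω
    refine (exp_le_one_add_add_sq_mul_exp_abs (s * W ω)).trans ?_
    have h1 : Real.exp |s * W ω| ≤ Real.exp (κ * W ω / 2) := by
      rw [abs_mul, abs_of_nonneg (hW ω)]
      exact Real.exp_le_exp.2 (by nlinarith [hW ω])
    have h2 : W ω ^ 2 ≤ 8 / κ ^ 2 * Real.exp (κ * W ω / 2) := by
      have := Real.quadratic_le_exp_of_nonneg (x := κ * W ω / 2)
        (by have := hW ω; positivity)
      rw [div_mul_eq_mul_div, le_div_iff₀ (by positivity)]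
      have h0 : 0 ≤ κ * W ω := mul_nonneg hκ.le (hW ω)
      nlinarith
    have h3 : Real.exp (κ * W ω) = Real.exp (κ * W ω / 2) * Real.exp (κ * W ω / 2) := by
      rw [← Real.exp_add]
      ring_nf
    calc 1 + s * W ω + (s * W ω) ^ 2 * Real.exp |s * W ω|
        = 1 + s * W ω + s ^ 2 * (W ω ^ 2 * Real.exp |s * W ω|) := by ring
      _ ≤ 1 + s * W ω + s ^ 2 * (8 / κ ^ 2 * Real.exp (κ * W ω / 2) *
            Real.exp (κ * W ω / 2)) := by gcongr
      _ = _ := by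
        rw [h3]
        ring
  have hbound : ∫ ω, Real.exp (s * W ω) ∂P ≤ 1 + s + 16 / κ ^ 2 * s ^ 2 := by
    have hi1 : Integrable (fun ω => 1 + s * W ω) P := (integrable_const 1).add (hWint.const_mul s)
    calc ∫ ω, Real.exp (s * W ω) ∂P
        ≤ ∫ ω, (1 + s * W ω + 8 / κ ^ 2 * s ^ 2 * Real.exp (κ * W ω)) ∂P :=
          integral_mono hsint (hi1.add (hint.const_mul _)) hpt
      _ = 1 + s + 8 / κ ^ 2 * s ^ 2 * ∫ ω, Real.exp (κ * W ω) ∂P := by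
          rw [integral_add hi1 (hint.const_mul _), integral_add (integrable_const 1)
            (hWint.const_mul s), integral_const_mul, integral_const_mul, hmean]
          simp
      _ ≤ 1 + s + 8 / κ ^ 2 * s ^ 2 * 2 := by gcongr
      _ = _ := by ring
  calc mgf (fun ω => W ω - 1) P s = Real.exp (-s) * ∫ ω, Real.exp (s * W ω) ∂P := by
        rw [mgf, ← integral_const_mul]
        simp only [hsplit]
    _ ≤ Real.exp (-s) * Real.exp (s + 16 / κ ^ 2 * s ^ 2) := by
        gcongr
        refine hbound.trans ?_
        have := Real.add_one_le_exp (s + 16 / κ ^ 2 * s ^ 2)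
        linarith
    _ = Real.exp (16 / κ ^ 2 * s ^ 2) := by
        rw [← Real.exp_add]
        ring_nf

/-- **Bernstein's inequality** for averages of independent centred variables whose moment generating
functions are at most `exp (K s²)` for `|s| ≤ s₀`. -/
theorem measureReal_abs_sum_ge_le {ι : Type*} [Fintype ι] [IsProbabilityMeasure P] {X : ι → Ω → ℝ}
    (hindep : iIndepFun X P) (hm : ∀ i, Measurable (X i)) {K s₀ : ℝ} (hK : 0 < K)
    (hmgf : ∀ i s, |s| ≤ s₀ →
      Integrable (fun ω => Real.exp (s * X i ω)) P ∧ mgf (X i) P s ≤ Real.exp (K * s ^ 2))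
    {t : ℝ} (ht : 0 ≤ t) (hts : t / (2 * K) ≤ s₀) :
    P.real {ω | Fintype.card ι * t ≤ |∑ i, X i ω|} ≤
      2 * Real.exp (-(Fintype.card ι * t ^ 2 / (4 * K))) := by
  have hs : 0 ≤ t / (2 * K) := by positivity
  have hsum : ∀ s, |s| ≤ s₀ → Integrable (fun ω => Real.exp (s * (∑ i, X i) ω)) P ∧
      mgf (∑ i, X i) P s ≤ Real.exp (Fintype.card ι * (K * s ^ 2)) := by
    intro s hs
    refine ⟨hindep.integrable_exp_mul_sum hm fun i _ => (hmgf i s hs).1, ?_⟩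
    rw [hindep.mgf_sum hm, ← nsmul_eq_mul, Real.exp_nsmul]
    exact (Finset.prod_le_prod (fun i _ => mgf_nonneg) fun i _ => (hmgf i s hs).2).trans
      (by simp)
  have hval : Real.exp (-(t / (2 * K)) * (Fintype.card ι * t)) *
      Real.exp (Fintype.card ι * (K * (t / (2 * K)) ^ 2)) =
        Real.exp (-(Fintype.card ι * t ^ 2 / (4 * K))) := by
    rw [← Real.exp_add]
    congr 1
    field_simp
    ring
  have hup : P.real {ω | Fintype.card ι * t ≤ (∑ i, X i) ω} ≤
      Real.exp (-(Fintype.card ι * t ^ 2 / (4 * K))) := by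
    obtain ⟨hi, hle⟩ := hsum _ (by rwa [abs_of_nonneg hs])
    refine (measure_ge_le_exp_mul_mgf _ hs hi).trans ?_
    rw [← hval]
    gcongr
  have hlow : P.real {ω | (∑ i, X i) ω ≤ -(Fintype.card ι * t)} ≤
      Real.exp (-(Fintype.card ι * t ^ 2 / (4 * K))) := by
    obtain ⟨hi, hle⟩ := hsum (-(t / (2 * K))) (by rwa [abs_neg, abs_of_nonneg hs])
    refine (measure_le_le_exp_mul_mgf _ (neg_nonpos.2 hs) hi).trans ?_
    rw [← hval, neg_neg, mul_neg, neg_mul]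
    rw [neg_sq] at hle
    gcongr
  calc P.real {ω | Fintype.card ι * t ≤ |∑ i, X i ω|}
      ≤ P.real ({ω | Fintype.card ι * t ≤ (∑ i, X i) ω} ∪
          {ω | (∑ i, X i) ω ≤ -(Fintype.card ι * t)}) := by
        refine measureReal_mono fun ω hω => ?_
        simp only [Set.mem_ofPred_eq, Set.mem_union, Finset.sum_apply] at hω ⊢
        rcases le_abs.1 hω with h | h
        · exact Or.inl h
        · exact Or.inr (by linarith)
    _ ≤ _ := measureReal_union_le _ _
    _ ≤ _ := by linarith

end Concentration

/-! ### The `ψ₂`-parameter is at least one -/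

/-- From `1 + Y² / c² ≤ exp (Y² / c²)` and `E exp (Y² / c²) ≤ 2` it follows that `E Y² ≤ c²`. -/
theorem one_le_of_psi2Norm_le {Ω : Type*} [MeasurableSpace Ω] {P : Measure Ω}
    [IsProbabilityMeasure P] {Y : Ω → ℝ} (hY : ∫ ω, Y ω ^ 2 ∂P = 1) {α : ℝ}
    (hα : psi2Norm P Y ≤ ENNReal.ofReal α) : 1 ≤ α := by
  by_contra! hlt
  have h1 : psi2Norm P Y < 1 := hα.trans_lt (by simpa using hlt)
  simp only [psi2Norm, iInf_lt_iff] at h1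
  obtain ⟨c, hc, hexp, hc1⟩ := h1
  have hc1 : c < 1 := by simpa using hc1
  have hint : Integrable (fun ω => Y ω ^ 2) P := by
    by_contra h
    rw [integral_undef h] at hY
    norm_num at hY
  have hint' : Integrable (fun ω => Y ω ^ 2 / c ^ 2 + 1) P :=
    (hint.div_const _).add (integrable_const 1)
  have hle : ENNReal.ofReal (1 / c ^ 2 + 1) ≤ ENNReal.ofReal 2 := by
    calc ENNReal.ofReal (1 / c ^ 2 + 1) = ENNReal.ofReal (∫ ω, (Y ω ^ 2 / c ^ 2 + 1) ∂P) := by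
          rw [integral_add (hint.div_const _) (integrable_const 1), integral_div, hY]
          simp
      _ = ∫⁻ ω, ENNReal.ofReal (Y ω ^ 2 / c ^ 2 + 1) ∂P :=
          ofReal_integral_eq_lintegral_ofReal hint' (ae_of_all _ fun ω => by positivity)
      _ ≤ ∫⁻ ω, ENNReal.ofReal (Real.exp (Y ω ^ 2 / c ^ 2)) ∂P :=
          lintegral_mono fun ω => ENNReal.ofReal_le_ofReal (Real.add_one_le_exp _)
      _ ≤ ENNReal.ofReal 2 := by simpa using hexp
  rw [ENNReal.ofReal_le_ofReal_iff (by norm_num)] at hle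
  have : 1 / c ^ 2 ≤ 1 := by linarith
  rw [div_le_one (by positivity)] at this
  nlinarith

namespace Tensor3

variable {n₁ n₂ n₃ m r : ℕ}

/-! ### From concentration to the tensor restricted isometry property -/

theorem norm_sq_measurementMap (A : Fin m → Tensor3 n₁ n₂ n₃) (X : Tensor3 n₁ n₂ n₃) :
    ‖measurementMap A X‖ ^ 2 = (m : ℝ)⁻¹ * ∑ i, (inner ℝ (A i) X : ℝ) ^ 2 := by
  rw [EuclideanSpace.real_norm_sq_eq, Finset.mul_sum]
  refine Finset.sum_congr rfl fun i _ => ?_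
  change ((√(m : ℝ))⁻¹ * inner ℝ (A i) X) ^ 2 = _
  rw [mul_pow, inv_pow, Real.sq_sqrt (Nat.cast_nonneg m)]

/-- For a fixed tensor `Z` of any tubal rank, `‖Φ Z‖²` is concentrated around `‖Z‖²`. -/
theorem measureReal_norm_sq_measurementMap_le {Ω : Type*} [MeasurableSpace Ω] {P : Measure Ω}
    [IsProbabilityMeasure P] {L : ℝ≥0} (hL : 0 < L) (hm : 0 < m)
    {A : Fin m → Ω → Tensor3 n₁ n₂ n₃} (hA : IsSubgaussianEnsemble P L A)
    (Z : Tensor3 n₁ n₂ n₃) {t : ℝ} (ht : 0 ≤ t) (ht1 : t ≤ 1) :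
    P.real {ω | t * ‖Z‖ ^ 2 < |‖measurementMap (fun i => A i ω) Z‖ ^ 2 - ‖Z‖ ^ 2|} ≤
      2 * Real.exp (-(m * t ^ 2 / (4 * (256 * L ^ 4 + 4 * L ^ 2)))) := by
  rcases eq_or_ne Z 0 with rfl | hZ
  · simp only [map_zero, norm_zero]
    norm_num
    positivity
  have hL' : (0 : ℝ) < L := hL
  have hm' : (0 : ℝ) < m := by exact_mod_cast hm
  have hZ' : 0 < ‖Z‖ := norm_pos_iff.2 hZ
  set z : Tensor3 n₁ n₂ n₃ := ‖Z‖⁻¹ • Z with hz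
  have hz1 : ‖z‖ = 1 := by
    rw [hz, norm_smul, norm_inv, norm_norm, inv_mul_cancel₀ hZ'.ne']
  have hZz : Z = ‖Z‖ • z := by rw [hz, smul_smul, mul_inv_cancel₀ hZ'.ne', one_smul]
  have hmeas : ∀ i, Measurable fun ω => (inner ℝ (A i ω) z : ℝ) := fun i =>
    (hA.measurable i).inner_const
  -- `⟨A i, z⟩` has variance proxy `L ^ 2`, so `exp (κ * ⟨A i, z⟩ ^ 2)` is integrable.
  set κ : ℝ := 1 / (4 * L ^ 2) with hκ
  have hκ0 : 0 < κ := by positivity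
  have hexp : ∀ i, ∫⁻ ω, ENNReal.ofReal (Real.exp (κ * (inner ℝ (A i ω) z : ℝ) ^ 2)) ∂P ≤ 2 := by
    intro i
    have hsub := hA.subgaussian i z
    have hz1' : ‖z‖₊ = 1 := NNReal.eq hz1
    rw [hz1', one_pow, mul_one] at hsub
    convert lintegral_exp_sq_le_of_hasSubgaussianMGF (pow_pos hL 2) (hmeas i) hsub using 5 with ω
    rw [hκ]
    push_cast
    ring
  have hindep : iIndepFun (fun i ω => (inner ℝ (A i ω) z : ℝ) ^ 2 - 1) P :=
    hA.indep.comp (fun _ x => (inner ℝ x z : ℝ) ^ 2 - 1) fun _ =>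
      ((measurable_id.inner_const).pow_const 2).sub_const 1
  -- The summand `4 * L ^ 2` in `K` makes `t / (2 * K) ≤ κ / 2` true for all `t ≤ 1`.
  have hbern := measureReal_abs_sum_ge_le hindep (fun i => ((hmeas i).pow_const 2).sub_const 1)
    (K := 256 * L ^ 4 + 4 * L ^ 2) (s₀ := κ / 2) (by positivity)
    (fun i s hs => by
      obtain ⟨h₁, h₂⟩ := mgf_sub_one_le_of_lintegral_exp_le hκ0 ((hmeas i).pow_const 2)
        (fun ω => sq_nonneg _) (by rw [hA.isotropic, hz1, one_pow]) (hexp i) hs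
      refine ⟨h₁, h₂.trans (Real.exp_le_exp.2 ?_)⟩
      have : 16 / κ ^ 2 = 256 * L ^ 4 := by
        rw [hκ]
        field_simp
        norm_num
      rw [this]
      nlinarith [mul_nonneg (sq_nonneg (L : ℝ)) (sq_nonneg s)])
    ht (by
      rw [hκ, div_div, div_le_div_iff₀ (by positivity) (by positivity)]
      nlinarith [pow_pos hL' 2, pow_pos hL' 4])
  rw [Fintype.card_fin] at hbern
  refine (measureReal_mono fun ω hω => ?_).trans hbern
  simp only [Set.mem_ofPred_eq] at hω ⊢
  have hnorm : ‖measurementMap (fun i => A i ω) Z‖ ^ 2 - ‖Z‖ ^ 2 =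
      ‖Z‖ ^ 2 * ((m : ℝ)⁻¹ * ∑ i, ((inner ℝ (A i ω) z : ℝ) ^ 2 - 1)) := by
    rw [norm_sq_measurementMap]
    conv_lhs => enter [1, 2, 2, i]; rw [hZz, inner_smul_right, mul_pow]
    rw [← Finset.mul_sum, Finset.sum_sub_distrib]
    simp only [Finset.sum_const, Finset.card_univ, Fintype.card_fin, nsmul_eq_mul, mul_one]
    field_simp
  rw [hnorm, abs_mul, abs_mul, abs_of_nonneg (sq_nonneg ‖Z‖), abs_of_pos (inv_pos.2 hm'),
    mul_comm t, mul_lt_mul_iff_right₀ (by positivity), inv_mul_eq_div, lt_div_iff₀ hm'] at hω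
  linarith

/-- The operators of left t-multiplication by an `n₁ × r × n₃` tensor. -/
noncomputable abbrev leftMulRange (n₁ r n₂ n₃ : ℕ) :
    Submodule ℝ (Tensor3 r n₂ n₃ →L[ℝ] Tensor3 n₁ n₂ n₃) :=
  LinearMap.range (leftMul n₁ r n₃ n₂)

theorem finrank_leftMulRange_le (n₁ r n₂ n₃ : ℕ) :
    Module.finrank ℝ (leftMulRange n₁ r n₂ n₃) ≤ n₁ * r * n₃ := by
  refine (LinearMap.finrank_range_le _).trans ?_
  simp [mul_assoc]

/-- The form measuring by how much `Φ` fails to preserve inner products. -/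
noncomputable def innerDefect (Φ : Tensor3 n₁ n₂ n₃ →ₗ[ℝ] EuclideanSpace ℝ (Fin m)) :
    Tensor3 n₁ n₂ n₃ →L[ℝ] Tensor3 n₁ n₂ n₃ →L[ℝ] ℝ :=
  (innerSL ℝ).bilinearComp (LinearMap.toContinuousLinearMap Φ) (LinearMap.toContinuousLinearMap Φ) -
    innerSL ℝ

theorem innerDefect_apply (Φ : Tensor3 n₁ n₂ n₃ →ₗ[ℝ] EuclideanSpace ℝ (Fin m))
    (X Y : Tensor3 n₁ n₂ n₃) :
    innerDefect Φ X Y = inner ℝ (Φ X) (Φ Y) - inner ℝ X Y := rfl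

/-- Polarization together with the parallelogram law: the form `innerDefect Φ` at `X` and `Y` is a
quarter of the difference of its diagonal values at `X + Y` and `X - Y`. -/
theorem abs_innerDefect_le (Φ : Tensor3 n₁ n₂ n₃ →ₗ[ℝ] EuclideanSpace ℝ (Fin m))
    {X Y : Tensor3 n₁ n₂ n₃} {t : ℝ} (ht : 0 ≤ t) (hX : ‖X‖ ≤ 1) (hY : ‖Y‖ ≤ 1)
    (hadd : |‖Φ (X + Y)‖ ^ 2 - ‖X + Y‖ ^ 2| ≤ t * ‖X + Y‖ ^ 2)
    (hsub : |‖Φ (X - Y)‖ ^ 2 - ‖X - Y‖ ^ 2| ≤ t * ‖X - Y‖ ^ 2) :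
    |innerDefect Φ X Y| ≤ t := by
  rw [map_add] at hadd
  rw [map_sub] at hsub
  have h₁ := norm_add_sq_real (Φ X) (Φ Y)
  have h₂ := norm_sub_sq_real (Φ X) (Φ Y)
  have h₃ := norm_add_sq_real X Y
  have h₄ := norm_sub_sq_real X Y
  have hX2 : ‖X‖ ^ 2 ≤ 1 := pow_le_one₀ (norm_nonneg _) hX
  have hY2 : ‖Y‖ ^ 2 ≤ 1 := pow_le_one₀ (norm_nonneg _) hY
  have hsum : t * ‖X + Y‖ ^ 2 + t * ‖X - Y‖ ^ 2 ≤ 4 * t := by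
    rw [h₃, h₄]
    nlinarith
  rw [abs_le] at hadd hsub
  rw [innerDefect_apply, abs_le]
  constructor <;> linarith [hadd.1, hadd.2, hsub.1, hsub.2]

/-- It suffices to control `innerDefect Φ` at products of net points. -/
theorem tripConst_le_of_net [NeZero n₃] (hr : r ≤ n₁)
    (Φ : Tensor3 n₁ n₂ n₃ →ₗ[ℝ] EuclideanSpace ℝ (Fin m))
    (s : Finset (leftMulRange n₁ r n₂ n₃)) (t : Finset (Tensor3 r n₂ n₃))
    (hs₁ : ∀ c ∈ s, ‖c‖ ≤ 1) (hs : ∀ x, ‖x‖ ≤ 1 → ∃ c ∈ s, ‖x - c‖ ≤ 1 / 8)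
    (ht₁ : ∀ c ∈ t, ‖c‖ ≤ 1) (ht : ∀ x, ‖x‖ ≤ 1 → ∃ c ∈ t, ‖x - c‖ ≤ 1 / 8)
    {δ : ℝ} (hδ : 0 ≤ δ) (hnet : ∀ a ∈ s, ∀ b ∈ t, ∀ a' ∈ s, ∀ b' ∈ t,
      |innerDefect Φ (a.1 b) (a'.1 b')| ≤ δ / 2) : tripConst Φ r ≤ δ := by
  have hall := abs_bilin_le_of_net (leftMulRange n₁ r n₂ n₃) (innerDefect Φ) s t
    hs₁ hs ht₁ ht (δ / 2) hnet
  refine csInf_le ⟨0, fun d hd => hd.1⟩ ⟨hδ, fun X hX => ?_⟩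
  obtain ⟨A, B, hAB, hB, hiso⟩ := exists_factorization_of_tubalRank_le hr hX
  rcases eq_or_ne X 0 with rfl | hX0
  · simp
  have hXpos : 0 < ‖X‖ := norm_pos_iff.2 hX0
  let a : leftMulRange n₁ r n₂ n₃ := ⟨leftMul n₁ r n₃ n₂ A, A, rfl⟩
  have ha : ‖a‖ ≤ 1 :=
    ContinuousLinearMap.opNorm_le_bound _ zero_le_one fun Z => by
      rw [one_mul]
      exact (hiso Z).le
  have hb : ‖‖X‖⁻¹ • B‖ ≤ 1 := by
    rw [norm_smul, norm_inv, norm_norm, hB, inv_mul_cancel₀ hXpos.ne']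
  have hx : a.1 (‖X‖⁻¹ • B) = ‖X‖⁻¹ • X := by
    rw [map_smul, hAB]
    rfl
  have h := hall a _ a _ ha hb ha hb
  rw [hx, innerDefect_apply, map_smul, real_inner_self_eq_norm_sq, real_inner_self_eq_norm_sq,
    norm_smul, norm_smul, norm_inv, norm_norm, mul_pow, mul_pow, ← mul_sub, abs_mul,
    abs_of_nonneg (by positivity), inv_pow, inv_mul_le_iff₀ (by positivity), abs_le] at h
  constructor <;> linarith [h.1, h.2]

/-- The union bound: for each of the at most `17 ^ (2 * (n₁ * r * n₃ + n₂ * r * n₃))` pairs of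
products of net points, the concentration bound is used at their sum and at their difference. -/
theorem measureReal_tripConst_le {Ω : Type*} [MeasurableSpace Ω] {P : Measure Ω}
    [IsProbabilityMeasure P] [NeZero n₃] {L : ℝ≥0} (hL : 0 < L) (hm : 0 < m) (hr : r ≤ n₁)
    {A : Fin m → Ω → Tensor3 n₁ n₂ n₃} (hA : IsSubgaussianEnsemble P L A)
    {δ : ℝ} (hδ : 0 ≤ δ) (hδ1 : δ ≤ 1) :
    1 - 4 * 17 ^ (2 * (n₁ * r * n₃ + n₂ * r * n₃)) *
        Real.exp (-(m * δ ^ 2 / (16 * (256 * L ^ 4 + 4 * L ^ 2)))) ≤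
      P.real {ω | tripConst (measurementMap fun i => A i ω) r ≤ δ} := by
  classical
  obtain ⟨s, hscard, hs₁, hs⟩ := exists_net_unitBall (leftMulRange n₁ r n₂ n₃)
  obtain ⟨t, htcard, ht₁, ht⟩ := exists_net_unitBall (Tensor3 r n₂ n₃)
  set η := Real.exp (-(m * δ ^ 2 / (16 * (256 * L ^ 4 + 4 * L ^ 2)))) with hη
  let bad (Z : Tensor3 n₁ n₂ n₃) : Set Ω :=
    {ω | δ / 2 * ‖Z‖ ^ 2 < |‖measurementMap (fun i => A i ω) Z‖ ^ 2 - ‖Z‖ ^ 2|}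
  have hbad : ∀ Z, P.real (bad Z) ≤ 2 * η := by
    intro Z
    refine (measureReal_norm_sq_measurementMap_le hL hm hA Z (by linarith) (by linarith)).trans_eq ?_
    rw [hη]
    congr 2
    rw [div_pow]
    field_simp
    ring
  let Q := (s ×ˢ t) ×ˢ (s ×ˢ t)
  let pt (q : leftMulRange n₁ r n₂ n₃ × Tensor3 r n₂ n₃) : Tensor3 n₁ n₂ n₃ := q.1.1 q.2
  have hpt : ∀ a ∈ s, ∀ b ∈ t, ‖pt (a, b)‖ ≤ 1 := fun a ha b hb =>
    (a.1.le_opNorm b).trans (mul_le_one₀ (hs₁ a ha) (norm_nonneg _) (ht₁ b hb))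
  let U : Set Ω := ⋃ q ∈ Q, (bad (pt q.1 + pt q.2) ∪ bad (pt q.1 - pt q.2))
  have hQ : (Q.card : ℝ) ≤ 17 ^ (2 * (n₁ * r * n₃ + n₂ * r * n₃)) := by
    have h₁ : s.card ≤ 17 ^ (n₁ * r * n₃) :=
      hscard.trans (Nat.pow_le_pow_right (by norm_num) (finrank_leftMulRange_le n₁ r n₂ n₃))
    have h₂ : t.card ≤ 17 ^ (n₂ * r * n₃) := by
      refine htcard.trans_eq ?_
      congr 1
      simp
      ring
    have h₃ : s.card * t.card ≤ 17 ^ (n₁ * r * n₃ + n₂ * r * n₃) := by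
      rw [pow_add]
      exact Nat.mul_le_mul h₁ h₂
    have h₄ : Q.card ≤ 17 ^ (2 * (n₁ * r * n₃ + n₂ * r * n₃)) := by
      simp only [Q, Finset.card_product]
      rw [two_mul, pow_add]
      exact Nat.mul_le_mul h₃ h₃
    exact_mod_cast h₄
  have hU : P.real U ≤ 4 * 17 ^ (2 * (n₁ * r * n₃ + n₂ * r * n₃)) * η := by
    calc P.real U ≤ ∑ q ∈ Q, P.real (bad (pt q.1 + pt q.2) ∪ bad (pt q.1 - pt q.2)) :=
          measureReal_biUnion_finset_le _ _
      _ ≤ ∑ _q ∈ Q, 4 * η := by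
          refine Finset.sum_le_sum fun q _ => (measureReal_union_le _ _).trans ?_
          linarith [hbad (pt q.1 + pt q.2), hbad (pt q.1 - pt q.2)]
      _ = Q.card * (4 * η) := by rw [Finset.sum_const, nsmul_eq_mul]
      _ ≤ 17 ^ (2 * (n₁ * r * n₃ + n₂ * r * n₃)) * (4 * η) := by gcongr
      _ = _ := by ring
  set G : Set Ω := {ω | tripConst (measurementMap fun i => A i ω) r ≤ δ} with hG
  have hcover : (Set.univ : Set Ω) ⊆ G ∪ U := by
    intro ω _
    by_cases hω : ω ∈ U
    · exact Or.inr hω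
    left
    have hgood : ∀ q ∈ Q, ω ∉ bad (pt q.1 + pt q.2) ∧ ω ∉ bad (pt q.1 - pt q.2) := by
      intro q hq
      rw [← not_or]
      exact fun h => hω (Set.mem_biUnion hq h)
    refine tripConst_le_of_net hr _ s t hs₁ hs ht₁ ht hδ fun a ha b hb a' ha' b' hb' => ?_
    obtain ⟨h₁, h₂⟩ := hgood ((a, b), (a', b'))
      (Finset.mk_mem_product (Finset.mk_mem_product ha hb) (Finset.mk_mem_product ha' hb'))
    exact abs_innerDefect_le _ (by linarith) (hpt a ha b hb) (hpt a' ha' b' hb')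
      (not_lt.1 h₁) (not_lt.1 h₂)
  have hone : 1 ≤ P.real G + P.real U := by
    calc 1 = P.real Set.univ := by simp
      _ ≤ P.real (G ∪ U) := measureReal_mono hcover
      _ ≤ _ := measureReal_union_le _ _
  linarith

end Tensor3

/-! ### The sample complexity -/

theorem theorem2 (L : ℝ≥0) (hL : 0 < L) :
    ∃ C : ℝ, 0 < C ∧
      ∀ (n₁ n₂ n₃ m r : ℕ) [NeZero n₃], 1 ≤ r → r ≤ n₁ → r ≤ n₂ →
      ∀ (δ ε α : ℝ), 0 < δ → δ < 1 → 0 < ε → ε < 1 → 0 < α →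
      ∀ (Ω : Type*) [MeasurableSpace Ω] (P : Measure Ω) [IsProbabilityMeasure P]
        (A : Fin m → Ω → Tensor3 n₁ n₂ n₃),
        IsSubgaussianEnsemble P L A → HasPsi2Parameter P α A →
        (m : ℝ) ≥ C * α ^ 2 * (δ ^ 2)⁻¹ *
          max (((r : ℝ) * r * n₃ + n₁ * r * n₃ + n₂ * r * n₃) * Real.log 2) (Real.log ε⁻¹) →
        P.real {ω | Tensor3.tripConst (Tensor3.measurementMap fun i => A i ω) r ≤ δ} ≥ 1 - ε := by
  have hL' : (0 : ℝ) < L := hL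
  set K : ℝ := 256 * L ^ 4 + 4 * L ^ 2 with hK
  have hKpos : 0 < K := by positivity
  -- `176 = 16 * 11`: with `M` the maximum in the bound on `m`, the exponent `m * δ ^ 2 / (16 * K)` is
  -- at least `11 * M`, of which the size of the nets uses up `10 * M` and the probability `ε` the rest.
  refine ⟨176 * K, by positivity, ?_⟩
  intro n₁ n₂ n₃ m r _ hr hr₁ hr₂ δ ε α hδ hδ1 hε hε1 hα Ω _ P _ A hA hψ hm
  set M := max (((r : ℝ) * r * n₃ + n₁ * r * n₃ + n₂ * r * n₃) * Real.log 2) (Real.log ε⁻¹)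
    with hM
  have hMpos : 0 < M := lt_max_of_lt_right (Real.log_pos ((one_lt_inv₀ hε).2 hε1))
  have hmpos : 0 < m := by
    have : (0 : ℝ) < m := lt_of_lt_of_le (by positivity) hm
    exact_mod_cast this
  have hn₃ : 0 < n₃ := Nat.pos_of_ne_zero (NeZero.ne n₃)
  -- Isotropy forces `1 ≤ α`, as `E Y² ≤ c²` whenever `E exp (Y² / c²) ≤ 2`.
  have hα1 : 1 ≤ α := by
    let X : Tensor3 n₁ n₂ n₃ :=
      EuclideanSpace.single (⟨0, by omega⟩, ⟨0, by omega⟩, ⟨0, hn₃⟩) 1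
    have hX : ‖X‖ = 1 := by simp [X]
    refine one_le_of_psi2Norm_le (P := P)
      (Y := fun ω => (inner ℝ (A ⟨0, hmpos⟩ ω) X : ℝ)) ?_ ?_
    · rw [hA.isotropic, hX, one_pow]
    · simpa [hX] using hψ ⟨0, hmpos⟩ X
  have hexponent : 11 * M ≤ m * δ ^ 2 / (16 * K) := by
    rw [le_div_iff₀ (by positivity)]
    have h₁ : 176 * K * (δ ^ 2)⁻¹ * M ≤ m := by
      refine le_trans ?_ hm
      have : 1 ≤ α ^ 2 := one_le_pow₀ hα1
      have h₀ : 0 ≤ 176 * K * (δ ^ 2)⁻¹ * M := by positivity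
      calc 176 * K * (δ ^ 2)⁻¹ * M ≤ α ^ 2 * (176 * K * (δ ^ 2)⁻¹ * M) :=
            le_mul_of_one_le_left h₀ this
        _ = _ := by ring
    calc 11 * M * (16 * K) = 176 * K * (δ ^ 2)⁻¹ * M * δ ^ 2 := by
          field_simp
          norm_num
      _ ≤ m * δ ^ 2 := by gcongr
  -- `4 * 17 ^ (2 d) ≤ 2 ^ (10 (d + 1))`, and `d + 1` is at most the dimension count in `M`.
  have hcount : (4 : ℝ) * 17 ^ (2 * (n₁ * r * n₃ + n₂ * r * n₃)) ≤ Real.exp (10 * M) := by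
    set d := n₁ * r * n₃ + n₂ * r * n₃ with hd
    have h₁ : (4 : ℝ) * 17 ^ (2 * d) ≤ 2 ^ (10 * (d + 1)) := by
      calc (4 : ℝ) * 17 ^ (2 * d) ≤ 2 ^ 10 * (2 ^ 5) ^ (2 * d) := by gcongr <;> norm_num
        _ = 2 ^ (10 * (d + 1)) := by
          rw [← pow_mul, ← pow_add]
          ring_nf
    have h₂ : ((d + 1 : ℕ) : ℝ) * Real.log 2 ≤ M := by
      refine le_trans ?_ (le_max_left _ _)
      have h₃ : d + 1 ≤ r * r * n₃ + n₁ * r * n₃ + n₂ * r * n₃ := by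
        have : 0 < r * r * n₃ := by positivity
        omega
      have h₄ : ((d + 1 : ℕ) : ℝ) ≤ (r : ℝ) * r * n₃ + n₁ * r * n₃ + n₂ * r * n₃ := by
        exact_mod_cast h₃
      exact mul_le_mul_of_nonneg_right h₄ (Real.log_nonneg (by norm_num))
    calc (4 : ℝ) * 17 ^ (2 * d) ≤ 2 ^ (10 * (d + 1)) := h₁
      _ = Real.exp (10 * (((d + 1 : ℕ) : ℝ) * Real.log 2)) := by
        rw [show 10 * (((d + 1 : ℕ) : ℝ) * Real.log 2) = ((10 * (d + 1) : ℕ) : ℝ) * Real.log 2 by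
          push_cast
          ring, Real.exp_nat_mul, Real.exp_log (by norm_num)]
      _ ≤ Real.exp (10 * M) := by gcongr
  have hfail : 4 * 17 ^ (2 * (n₁ * r * n₃ + n₂ * r * n₃)) *
      Real.exp (-(m * δ ^ 2 / (16 * K))) ≤ ε := by
    calc 4 * 17 ^ (2 * (n₁ * r * n₃ + n₂ * r * n₃)) * Real.exp (-(m * δ ^ 2 / (16 * K)))
        ≤ Real.exp (10 * M) * Real.exp (-(11 * M)) := by gcongr
      _ = Real.exp (-M) := by
        rw [← Real.exp_add]
        ring_nf
      _ ≤ Real.exp (-Real.log ε⁻¹) := by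
        gcongr
        exact le_max_right _ _
      _ = ε := by rw [Real.log_inv, neg_neg, Real.exp_log hε]
  have := Tensor3.measureReal_tripConst_le hL hmpos hr₁ hA hδ.le hδ1.le
  linarith
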